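/- An oriented virtual knot diagram $D$ is an oriented closed immersed ($C^1$) curve in the plane whose multiple points are finitely many transverse double points, some of them marked as classical crossings (with a choice of over-branch and under-branch), the others being virtual crossings. For an ordered pair of branches $(\alpha,\beta)$ at a crossing put $\varepsilon(\alpha,\beta)=+1$ if $\beta$ crosses $\alpha$ from right to left and $\varepsilon(\alpha,\beta)=-1$ if $\beta$ crosses $\alpha$ from left to right. The sign of a classical crossing $c$ is $\operatorname{sign}(c)=\varepsilon(\text{over-branch},\text{under-branch})$. A long arc of $D$ is the part of the curve between two consecutive passages through classical crossings; the long arcs are the edges of the covering graph $\tilde D$, whose vertices are the classical crossings. The virtual index cocycle $vi_D\in C^1(\tilde D,\mathbb Z)$ assigns to a long arc $e$ the sum of $\varepsilon(\alpha,\beta)$ over all passages of $e$ through virtual crossings, where $\alpha$ is the passing branch (part of $e$) and $\beta$ is the other branch at that crossing. The oriented smoothing at a classical crossing $c$ splits $D$ into two closed curves, the left half $D^l_c$ and the right half $D^r_c$, where $D^l_c$ is the one that leaves $c$ along the left outgoing branch. Let $D^+_c=D^l_c$ if $\operatorname{sign}(c)=+1$ and $D^+_c=D^r_c$ if $\operatorname{sign}(c)=-1$.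 The virtual index of $c$ is $vInd_D(c)=vi_D(D^+_c)$, the sum of $vi_D$ over the long arcs that form $D^+_c$. Cheng's index $Ind_D(c)$ is the sum, over all passages of $D^+_c$ through classical crossings (not counting the point $c$ at which $D^+_c$ starts and ends), of the intersection number at that passage, which is $+1$ if the other branch crosses $D^+_c$ from left to right and $-1$ if it crosses from right to left. Then for every oriented virtual knot diagram $D$ and every classical crossing $c$ of $D$, $$vInd_D(c)=Ind_D(c).$$ -/

import Mathlib

/-- An oriented closed `C¹` immersed curve in the plane: a `1`-periodic `C¹` map `ℝ → ℝ²` with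
nowhere vanishing derivative.  The orientation is that of increasing parameter. -/
structure ImmersedClosedCurve where
  curve : ℝ → ℝ × ℝ
  contDiff : ContDiff ℝ 1 curve
  periodic : Function.Periodic curve 1
  immersion : ∀ x, deriv curve x ≠ 0

namespace ImmersedClosedCurve

theorem periodic_deriv (γ : ImmersedClosedCurve) : Function.Periodic (deriv γ.curve) 1 := by
  intro x
  have h : (fun y => γ.curve (y + 1)) = γ.curve := funext γ.periodic
  rw [← deriv_comp_add_const, h]

/-- The curve as a map from the circle `ℝ / ℤ`. -/
def point (γ : ImmersedClosedCurve) : UnitAddCircle → ℝ × ℝ := γ.periodic.lift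

/-- The velocity vector of the curve, as a function on the circle `ℝ / ℤ`. -/
noncomputable def velocity (γ : ImmersedClosedCurve) : UnitAddCircle → ℝ × ℝ :=
  γ.periodic_deriv.lift

/-- The oriented area `det (v(s), v(t))` spanned by the velocities at the parameters `s`, `t`.
It is positive when the frame `(v(s), v(t))` is counterclockwise, that is, when the branch at `t`
crosses the branch at `s` from right to left. -/
noncomputable def det (γ : ImmersedClosedCurve) (s t : UnitAddCircle) : ℝ :=
  (γ.velocity s).1 * (γ.velocity t).2 - (γ.velocity s).2 * (γ.velocity t).1

/-- Ordered pairs of distinct parameters at which the curve passes through the same point. -/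
def doublePairs (γ : ImmersedClosedCurve) : Set (UnitAddCircle × UnitAddCircle) :=
  {p | p.1 ≠ p.2 ∧ γ.point p.1 = γ.point p.2}

end ImmersedClosedCurve

/-- An oriented virtual knot diagram: a closed immersed plane curve whose multiple points are
finitely many transverse double points, some of which are marked as classical crossings and carry
the information which branch passes over; all the other double points are virtual crossings. -/
structure VirtualKnotDiagram extends ImmersedClosedCurve where
  finite_doublePairs : toImmersedClosedCurve.doublePairs.Finite
  no_triple : ∀ s t u, (s, t) ∈ toImmersedClosedCurve.doublePairs →
    (s, u) ∈ toImmersedClosedCurve.doublePairs → t = u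
  transverse : ∀ s t, (s, t) ∈ toImmersedClosedCurve.doublePairs →
    toImmersedClosedCurve.det s t ≠ 0
  /-- The classical crossings, each given as the pair (parameter of the over-passage, parameter of
  the under-passage). -/
  crossings : Set (UnitAddCircle × UnitAddCircle)
  crossings_subset : crossings ⊆ toImmersedClosedCurve.doublePairs
  swap_notMem : ∀ c ∈ crossings, c.swap ∉ crossings

namespace VirtualKnotDiagram

/-- Classical crossings of the diagram. -/
def Crossing (D : VirtualKnotDiagram) : Type := {c // c ∈ D.crossings}

/-- Parameter of the over-passage of a classical crossing. -/
def Crossing.over {D : VirtualKnotDiagram} (c : D.Crossing) : UnitAddCircle := c.1.1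

/-- Parameter of the under-passage of a classical crossing. -/
def Crossing.under {D : VirtualKnotDiagram} (c : D.Crossing) : UnitAddCircle := c.1.2

/-- The sign of a classical crossing: `+1` if the frame (over, under) is counterclockwise,
`-1` otherwise. -/
noncomputable def Crossing.sign {D : VirtualKnotDiagram} (c : D.Crossing) : ℤ :=
  SignType.sign (D.det c.over c.under)

/-- Ordered pairs (parameter of one passage, parameter of the other passage) through classical
crossings; each crossing gives two of them. -/
def classicalPairs (D : VirtualKnotDiagram) : Set (UnitAddCircle × UnitAddCircle) :=
  {p | p ∈ D.crossings ∨ p.swap ∈ D.crossings}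

theorem classicalPairs_subset (D : VirtualKnotDiagram) : D.classicalPairs ⊆ D.doublePairs := by
  rintro p (h | h)
  · exact D.crossings_subset h
  · have := D.crossings_subset h
    exact ⟨this.1.symm, this.2.symm⟩

/-- Ordered pairs (parameter of one passage, parameter of the other passage) through virtual
crossings; each virtual crossing gives two of them. -/
def virtualPairs (D : VirtualKnotDiagram) : Set (UnitAddCircle × UnitAddCircle) :=
  D.doublePairs \ D.classicalPairs

theorem finite_classicalPairs (D : VirtualKnotDiagram) : D.classicalPairs.Finite :=
  D.finite_doublePairs.subset D.classicalPairs_subset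

theorem finite_virtualPairs (D : VirtualKnotDiagram) : D.virtualPairs.Finite :=
  D.finite_doublePairs.subset Set.sdiff_subset

/-- The parameters at which the curve passes through a classical crossing. -/
def classicalPassages (D : VirtualKnotDiagram) : Set UnitAddCircle :=
  Prod.fst '' D.classicalPairs

/-- The pairs `(a, b)` of consecutive classical passages.  `Set.cIoo a b` is the open arc of the
circle from `a` to `b` in the direction of increasing parameter. -/
def longArcs (D : VirtualKnotDiagram) : Set (UnitAddCircle × UnitAddCircle) :=
  {e | e.1 ∈ D.classicalPassages ∧ e.2 ∈ D.classicalPassages ∧ e.1 ≠ e.2 ∧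
    Disjoint (Set.cIoo e.1 e.2) D.classicalPassages}

/-- The long arcs of the diagram, i.e. the edges of its covering graph (whose vertices are the
classical crossings). -/
def LongArc (D : VirtualKnotDiagram) : Type := {e // e ∈ D.longArcs}

instance (D : VirtualKnotDiagram) : Finite D.LongArc := by
  have h : D.classicalPassages.Finite := D.finite_classicalPairs.image _
  exact ((h.prod h).subset fun e he => ⟨he.1, he.2.1⟩).to_subtype

noncomputable instance (D : VirtualKnotDiagram) : Fintype D.LongArc := Fintype.ofFinite _

/-- The interior of a long arc, as a set of parameters. -/
def LongArc.interior {D : VirtualKnotDiagram} (e : D.LongArc) : Set UnitAddCircle :=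
  Set.cIoo e.1.1 e.1.2

open Classical in
/-- The virtual index cocycle, a `1`-cochain on the covering graph: its value on a long arc is the
sum, over the passages of the arc through virtual crossings, of the sign of the virtual crossing
with respect to the passing branch.  This sign is `+1` if the other branch crosses the passing one
from right to left, and `-1` if it crosses from left to right. -/
noncomputable def virtualIndexCocycle (D : VirtualKnotDiagram) (e : D.LongArc) : ℤ :=
  ∑ p ∈ D.finite_virtualPairs.toFinset with p.1 ∈ e.interior, (SignType.sign (D.det p.1 p.2) : ℤ)

/-- An oriented arc of the circle, from `source` to `target` in the direction of increasing
parameter. -/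
structure Arc where
  source : UnitAddCircle
  target : UnitAddCircle

/-- The open arc, as a set of parameters. -/
def Arc.interior (A : Arc) : Set UnitAddCircle := Set.cIoo A.source A.target

open Classical in
/-- The value of a `1`-cochain on an arc that joins two classical passages: the sum of its values
on the long arcs of which the arc consists. -/
noncomputable def eval {D : VirtualKnotDiagram} (f : D.LongArc → ℤ) (A : Arc) : ℤ :=
  ∑ e : D.LongArc with e.interior ⊆ A.interior, f e

open Classical in
/-- The left half of the diagram at `c`: the oriented smoothing at `c` splits the diagram into two
closed curves, and the left half is the one which leaves `c` along the left outgoing branch (and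
comes back along the left incoming branch). The under-branch is the left outgoing one exactly if
the frame (over, under) is counterclockwise. -/
noncomputable def Crossing.leftHalf {D : VirtualKnotDiagram} (c : D.Crossing) : Arc :=
  if 0 < D.det c.over c.under then ⟨c.under, c.over⟩ else ⟨c.over, c.under⟩

open Classical in
/-- The right half of the diagram at `c`: the other half of the oriented smoothing at `c`. -/
noncomputable def Crossing.rightHalf {D : VirtualKnotDiagram} (c : D.Crossing) : Arc :=
  if 0 < D.det c.over c.under then ⟨c.over, c.under⟩ else ⟨c.under, c.over⟩

/-- The positive half of the diagram at `c`: the left half if `c` is positive, the right half if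
`c` is negative. -/
noncomputable def Crossing.positiveHalf {D : VirtualKnotDiagram} (c : D.Crossing) : Arc :=
  if c.sign = 1 then c.leftHalf else c.rightHalf

/-- The virtual index of a classical crossing: the value of the virtual index cocycle on the
positive half. -/
noncomputable def virtualIndex (D : VirtualKnotDiagram) (c : D.Crossing) : ℤ :=
  eval D.virtualIndexCocycle c.positiveHalf

open Classical in
/-- The (classical) index of a classical crossing: the sum of the intersection numbers of the
classical crossings over all passages of the positive half through classical crossings (other than
the point `c` at which the half starts and ends).  The intersection number at such a passage is
`+1` if the other branch crosses the positive half from left to right, and `-1` if it crosses from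
right to left. -/
noncomputable def index (D : VirtualKnotDiagram) (c : D.Crossing) : ℤ :=
  ∑ p ∈ D.finite_classicalPairs.toFinset with p.1 ∈ c.positiveHalf.interior,
    (SignType.sign (D.det p.2 p.1) : ℤ)

end VirtualKnotDiagram

open MeasureTheory Set Topology UnitAddCircle

/-! Whatever the sign of `c`, its positive half is the arc from the under-passage to the
over-passage. The theorem follows once the signs over all passages of this half, virtual and
classical together, sum to zero: the virtual sum is then minus the classical one, and the minus sign
reverses the branches as in Cheng's index. Crossings of the half with itself cancel in pairs by
antisymmetry. What remains is the intersection number of the two halves, two closed plane curves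
(`sum_sign_velocityDet_eq_zero`).

That number is computed as a degree. The difference map `γ t - γ s` on the product of the two
parameter intervals identifies opposite sides, and an exact 2-form pulls back to integral zero. A
bump form concentrated near the origin has integral equal to the signed count of transverse zeros
times its mass. The smoothed crossing itself gives spurious zeros at the four corners; near them the
map stays in a closed half-plane, and the bump is placed in the opposite open half-plane. -/

/-! ### Exact forms pulled back by the difference map -/

theorem setIntegral_rectangle_eq_zero_of_fst {a b c d : ℝ} {G : ℝ × ℝ → ℝ} (hG : Continuous G)
    (h : ∀ t, ∫ s in Icc a b, G (s, t) = 0) : ∫ z in Icc a b ×ˢ Icc c d, G z = 0 := by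
  have hi : IntegrableOn G (Icc a b ×ˢ Icc c d) :=
    hG.continuousOn.integrableOn_compact (isCompact_Icc.prod isCompact_Icc)
  rw [IntegrableOn, Measure.volume_eq_prod, ← Measure.prod_restrict] at hi
  rw [Measure.volume_eq_prod, ← Measure.prod_restrict, integral_prod_symm _ hi]
  simp [h]

theorem setIntegral_rectangle_eq_zero_of_snd {a b c d : ℝ} {G : ℝ × ℝ → ℝ} (hG : Continuous G)
    (h : ∀ s, ∫ t in Icc c d, G (s, t) = 0) : ∫ z in Icc a b ×ˢ Icc c d, G z = 0 := by
  have hi : IntegrableOn G (Icc a b ×ˢ Icc c d) :=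
    hG.continuousOn.integrableOn_compact (isCompact_Icc.prod isCompact_Icc)
  rw [Measure.volume_eq_prod, setIntegral_prod _ hi]
  simp [h]

theorem setIntegral_Icc_deriv_eq_zero {a b : ℝ} (hab : a ≤ b) {q q' : ℝ → ℝ}
    (hq : ∀ x, HasDerivAt q (q' x) x) (hc : Continuous q') (h : q a = q b) :
    ∫ s in Icc a b, q' s = 0 := by
  rw [integral_Icc_eq_integral_Ioc, ← intervalIntegral.integral_of_le hab,
    intervalIntegral.integral_eq_sub_of_hasDerivAt (fun x _ => hq x) (hc.intervalIntegrable _ _),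
    h, sub_self]

/-- The difference of two points of a plane curve, as a function of the two parameters. -/
def curveDifference (γ : ℝ → ℝ × ℝ) (z : ℝ × ℝ) : ℝ × ℝ := γ z.2 - γ z.1

/-- The oriented area spanned by two velocities of a plane curve. -/
noncomputable def velocityDet (γ : ℝ → ℝ × ℝ) (z : ℝ × ℝ) : ℝ :=
  (deriv γ z.1).1 * (deriv γ z.2).2 - (deriv γ z.1).2 * (deriv γ z.2).1

theorem hasDerivAt_fst_of_contDiff {γ : ℝ → ℝ × ℝ} (h : ContDiff ℝ 1 γ) (x : ℝ) :
    HasDerivAt (fun s => (γ s).1) (deriv γ x).1 x :=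
  (h.differentiable one_ne_zero x).hasDerivAt.fst

theorem hasDerivAt_snd_of_contDiff {γ : ℝ → ℝ × ℝ} (h : ContDiff ℝ 1 γ) (x : ℝ) :
    HasDerivAt (fun s => (γ s).2) (deriv γ x).2 x :=
  (h.differentiable one_ne_zero x).hasDerivAt.snd

theorem continuous_velocityDet {γ : ℝ → ℝ × ℝ} (h : ContDiff ℝ 1 γ) :
    Continuous (velocityDet γ) := by
  have := h.continuous_deriv le_rfl
  unfold velocityDet
  fun_prop

theorem continuous_curveDifference {γ : ℝ → ℝ × ℝ} (h : ContDiff ℝ 1 γ) :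
    Continuous (curveDifference γ) := by
  have := h.continuous
  unfold curveDifference
  fun_prop

/-- The pull-back of a `2`-form with separated variables under the difference map of two closed
loops has integral zero. -/
theorem setIntegral_curveDifference_eq_zero {γ : ℝ → ℝ × ℝ} (hγ : ContDiff ℝ 1 γ) {a b d : ℝ}
    (hab : a ≤ b) (hbd : b ≤ d) (h₁ : γ a = γ b) (h₂ : γ b = γ d) {f k : ℝ → ℝ}
    (hf : Continuous f) (hk : ContDiff ℝ 1 k) :
    ∫ z in Icc a b ×ˢ Icc b d,
      f (curveDifference γ z).1 * k (curveDifference γ z).2 * velocityDet γ z = 0 := by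
  have hc := hγ.continuous
  have hc' := hγ.continuous_deriv le_rfl
  have hk0 := hk.continuous
  have hk' := hk.continuous_deriv le_rfl
  have hdk (x : ℝ) : HasDerivAt k (deriv k x) x := (hk.differentiable one_ne_zero x).hasDerivAt
  -- The form `f(x) k(y) dx ∧ dy` is the differential of `Φ(x) k(y) dy`.
  set Φ : ℝ → ℝ := fun x => ∫ u in (0 : ℝ)..x, f u with hΦ
  have hdΦ (x : ℝ) : HasDerivAt Φ (f x) x := intervalIntegral.integral_hasDerivAt_right
    (hf.intervalIntegrable _ _) (hf.stronglyMeasurableAtFilter _ _) hf.continuousAt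
  have hΦc : Continuous Φ := continuous_iff_continuousAt.2 fun x => (hdΦ x).continuousAt
  have hdx := hasDerivAt_fst_of_contDiff hγ
  have hdy := hasDerivAt_snd_of_contDiff hγ
  -- `P` and `R` are the partial derivatives of `Φ k` in `s` and in `t`, each times a velocity
  -- component of the other variable. This component is constant in the integration, so `C¹`
  -- regularity suffices; the terms with `deriv k` cancel in `P + R`.
  set P : ℝ × ℝ → ℝ := fun z => (deriv γ z.2).2 *
    (f ((γ z.2).1 - (γ z.1).1) * (-(deriv γ z.1).1) * k ((γ z.2).2 - (γ z.1).2) +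
      Φ ((γ z.2).1 - (γ z.1).1) * (deriv k ((γ z.2).2 - (γ z.1).2) * (-(deriv γ z.1).2))) with hP
  set R : ℝ × ℝ → ℝ := fun z => (deriv γ z.1).2 *
    (f ((γ z.2).1 - (γ z.1).1) * (deriv γ z.2).1 * k ((γ z.2).2 - (γ z.1).2) +
      Φ ((γ z.2).1 - (γ z.1).1) * (deriv k ((γ z.2).2 - (γ z.1).2) * (deriv γ z.2).2)) with hR
  have hPc : Continuous P := by fun_prop
  have hRc : Continuous R := by fun_prop
  have hcomp : IsCompact (Icc a b ×ˢ Icc b d) := isCompact_Icc.prod isCompact_Icc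
  have hP0 : ∫ z in Icc a b ×ˢ Icc b d, P z = 0 := by
    refine setIntegral_rectangle_eq_zero_of_fst hPc fun t => ?_
    simp only [hP]
    rw [integral_const_mul, setIntegral_Icc_deriv_eq_zero hab
      (q := fun s => Φ ((γ t).1 - (γ s).1) * k ((γ t).2 - (γ s).2)), mul_zero]
    · intro s
      exact ((hdΦ _).comp s ((hdx s).const_sub _)).mul ((hdk _).comp s ((hdy s).const_sub _))
    · fun_prop
    · simp only [h₁]
  have hR0 : ∫ z in Icc a b ×ˢ Icc b d, R z = 0 := by
    refine setIntegral_rectangle_eq_zero_of_snd hRc fun s => ?_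
    simp only [hR]
    rw [integral_const_mul, setIntegral_Icc_deriv_eq_zero hbd
      (q := fun t => Φ ((γ t).1 - (γ s).1) * k ((γ t).2 - (γ s).2)), mul_zero]
    · intro t
      exact ((hdΦ _).comp t ((hdx t).sub_const _)).mul ((hdk _).comp t ((hdy t).sub_const _))
    · fun_prop
    · simp only [h₂]
  have hsum : ∀ z, f (curveDifference γ z).1 * k (curveDifference γ z).2 * velocityDet γ z =
      -(P z + R z) := by
    intro z
    simp only [hP, hR, curveDifference, velocityDet, Prod.fst_sub, Prod.snd_sub]
    ring
  simp_rw [hsum]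
  rw [integral_neg, integral_add (hPc.continuousOn.integrableOn_compact hcomp)
    (hRc.continuousOn.integrableOn_compact hcomp), hP0, hR0, add_zero, neg_zero]

/-! ### Local degree at a transverse zero -/

theorem hasStrictFDerivAt_curveDifference {γ : ℝ → ℝ × ℝ} (hγ : ContDiff ℝ 1 γ) (z : ℝ × ℝ) :
    HasStrictFDerivAt (curveDifference γ)
      ((ContinuousLinearMap.snd ℝ ℝ ℝ).smulRight (deriv γ z.2) -
        (ContinuousLinearMap.fst ℝ ℝ ℝ).smulRight (deriv γ z.1)) z := by
  have h (x : ℝ) : HasStrictDerivAt γ (deriv γ x) x := hγ.hasStrictDerivAt one_ne_zero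
  exact (((h z.2).hasStrictFDerivAt.comp z hasStrictFDerivAt_snd).sub
    ((h z.1).hasStrictFDerivAt.comp z hasStrictFDerivAt_fst)).congr_fderiv (by ext <;> simp)

theorem det_smulRight_sub_smulRight (u v : ℝ × ℝ) :
    ((ContinuousLinearMap.snd ℝ ℝ ℝ).smulRight v -
      (ContinuousLinearMap.fst ℝ ℝ ℝ).smulRight u).det = -(u.1 * v.2 - u.2 * v.1) := by
  rw [ContinuousLinearMap.det, ← LinearMap.det_toMatrix (Module.Basis.finTwoProd ℝ),
    Matrix.det_fin_two]
  simp [LinearMap.toMatrix_apply]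
  ring

/-- Near a transverse zero, the difference map is a local homeomorphism, and the integral of the
pull-back of a bump form is the sign of the zero times the integral of the form. -/
theorem exists_nhds_setIntegral_curveDifference {γ : ℝ → ℝ × ℝ} (hγ : ContDiff ℝ 1 γ)
    {z : ℝ × ℝ} (hz : γ z.1 = γ z.2) (hJ : velocityDet γ z ≠ 0) {W : Set (ℝ × ℝ)}
    (hW : IsOpen W) (hzW : z ∈ W) :
    ∃ U ⊆ W, IsOpen U ∧ z ∈ U ∧ ∃ r > 0, ∀ φ : ℝ × ℝ → ℝ, (∀ p ∉ Metric.ball 0 r, φ p = 0) →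
      ∫ w in U, φ (curveDifference γ w) * velocityDet γ w =
        (SignType.sign (velocityDet γ z) : ℤ) * ∫ p, φ p := by
  set F' : ℝ × ℝ → (ℝ × ℝ →L[ℝ] ℝ × ℝ) := fun w =>
    (ContinuousLinearMap.snd ℝ ℝ ℝ).smulRight (deriv γ w.2) -
        (ContinuousLinearMap.fst ℝ ℝ ℝ).smulRight (deriv γ w.1) with hF'
  have hF (w) : HasStrictFDerivAt (curveDifference γ) (F' w) w :=
    hasStrictFDerivAt_curveDifference hγ w
  have hdet (w) : (F' w).det = -velocityDet γ w := det_smulRight_sub_smulRight _ _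
  have hne : (F' z).det ≠ 0 := by rw [hdet]; exact neg_ne_zero.2 hJ
  set e : (ℝ × ℝ) ≃L[ℝ] ℝ × ℝ := (F' z).toContinuousLinearEquivOfDetNeZero hne with he
  have hFe : HasStrictFDerivAt (curveDifference γ) (e : ℝ × ℝ →L[ℝ] ℝ × ℝ) z := by
    exact (hF z).congr_fderiv (by ext <;> rfl)
  set E := hFe.toOpenPartialHomeomorph (curveDifference γ) with hE
  have hzE : z ∈ E.source := hFe.mem_toOpenPartialHomeomorph_source
  have hcoe : (E : ℝ × ℝ → ℝ × ℝ) = curveDifference γ := hFe.toOpenPartialHomeomorph_coe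
  -- On `S` the Jacobian keeps its sign, so the absolute value in the change of variables becomes a
  -- constant sign.
  set S : Set (ℝ × ℝ) := {w | 0 < velocityDet γ z * velocityDet γ w} with hS
  have hSo : IsOpen S := isOpen_lt continuous_const
    (continuous_const.mul (continuous_velocityDet hγ))
  set U := E.source ∩ (W ∩ S) with hU
  have hUo : IsOpen U := E.open_source.inter (hW.inter hSo)
  have hzU : z ∈ U := ⟨hzE, hzW, mul_self_pos.2 hJ⟩
  have him : IsOpen (curveDifference γ '' U) := by
    rw [← hcoe]; exact E.isOpen_image_of_subset_source hUo inter_subset_left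
  have h0 : (0 : ℝ × ℝ) ∈ curveDifference γ '' U := ⟨z, hzU, by simp [curveDifference, hz]⟩
  obtain ⟨r, hr, hball⟩ := Metric.isOpen_iff.1 him 0 h0
  refine ⟨U, fun w hw => hw.2.1, hUo, hzU, r, hr, fun φ hφ => ?_⟩
  have hinj : InjOn (curveDifference γ) U := by
    rw [← hcoe]; exact E.injOn.mono inter_subset_left
  have hcv := integral_image_eq_integral_abs_det_fderiv_smul volume hUo.measurableSet
    (fun w _ => (hF w).hasFDerivAt.hasFDerivWithinAt) hinj φ
  rw [setIntegral_eq_integral_of_forall_compl_eq_zero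
    (fun p hp => hφ p fun h => hp (hball h))] at hcv
  rw [hcv, ← integral_const_mul]
  refine setIntegral_congr_fun hUo.measurableSet fun w hw => ?_
  have hpos : 0 < velocityDet γ z * velocityDet γ w := hw.2.2
  simp only [hdet, abs_neg, smul_eq_mul]
  rcases lt_or_gt_of_ne hJ with h | h
  · have : velocityDet γ w < 0 := by nlinarith
    rw [abs_of_neg this, sign_neg h]; simp; ring
  · have : 0 < velocityDet γ w := by nlinarith
    rw [abs_of_pos this, sign_pos h]; simp; ring

/-! ### Intersection number of the two loops of a smoothing -/

/-- The product form covers both sides of `x` at once; the loops use one side at each of their ends.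
-/
theorem HasDerivAt.eventually_sub_mul_sub_nonneg {h : ℝ → ℝ} {h' x : ℝ} (hd : HasDerivAt h h' x)
    (hpos : 0 < h') : ∀ᶠ y in 𝓝 x, 0 ≤ (y - x) * (h y - h x) := by
  have h1 := (hasDerivAt_iff_tendsto_slope.1 hd).eventually (lt_mem_nhds hpos)
  rw [eventually_nhdsWithin_iff] at h1
  filter_upwards [h1] with y hy
  rcases eq_or_ne y x with rfl | hne
  · simp
  · have := hy hne
    rw [slope_def_field] at this
    have hsq : 0 < (y - x) ^ 2 := by have := sub_ne_zero.2 hne; positivity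
    have : (y - x) * (h y - h x) = (h y - h x) / (y - x) * (y - x) ^ 2 := by
      field_simp [sub_ne_zero.2 hne]
    rw [this]; positivity

/-- A bump function with separated variables on the plane. -/
theorem exists_separated_bump (q : ℝ × ℝ) {r : ℝ} (hr : 0 < r) :
    ∃ f k : ℝ → ℝ, Continuous f ∧ ContDiff ℝ 1 k ∧
      (∀ p : ℝ × ℝ, p ∉ Metric.ball q r → f p.1 * k p.2 = 0) ∧
      0 < ∫ p : ℝ × ℝ, f p.1 * k p.2 := by
  let f : ContDiffBump q.1 := ⟨r / 2, r, half_pos hr, half_lt_self hr⟩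
  let k : ContDiffBump q.2 := ⟨r / 2, r, half_pos hr, half_lt_self hr⟩
  refine ⟨f, k, f.continuous, k.contDiff, fun p hp => ?_, ?_⟩
  · by_contra hne
    refine hp ?_
    have h1 : p.1 ∈ Function.support f := left_ne_zero_of_mul hne
    have h2 : p.2 ∈ Function.support k := right_ne_zero_of_mul hne
    rw [ContDiffBump.support_eq] at h1 h2
    rw [← ball_prod_same]
    exact ⟨h1, h2⟩
  · rw [Measure.volume_eq_prod, integral_prod_mul (f : ℝ → ℝ) (k : ℝ → ℝ)]
    exact mul_pos f.integral_pos k.integral_pos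

/-- Two loops `γ|[a, b]` and `γ|[b, d]`, obtained from a closed curve by smoothing a transverse
double point, have intersection number zero. -/
theorem sum_sign_velocityDet_eq_zero {γ : ℝ → ℝ × ℝ} (hγ : ContDiff ℝ 1 γ) {a b d : ℝ}
    (hab : a < b) (hbd : b < d) (h₁ : γ a = γ b) (h₂ : γ b = γ d) (hd : deriv γ a = deriv γ d)
    (hJ : velocityDet γ (a, b) ≠ 0) (hA : ∀ s ∈ Ioo a b, γ s ≠ γ b)
    (hB : ∀ t ∈ Ioo b d, γ t ≠ γ b) (Z : Finset (ℝ × ℝ))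
    (hZ : ∀ z, z ∈ Z ↔ z ∈ Ioo a b ×ˢ Ioo b d ∧ γ z.1 = γ z.2)
    (htr : ∀ z ∈ Z, velocityDet γ z ≠ 0) :
    ∑ z ∈ Z, (SignType.sign (velocityDet γ z) : ℤ) = 0 := by
  have hFc := continuous_curveDifference hγ
  have hJc := continuous_velocityDet hγ
  set R : Set (ℝ × ℝ) := Icc a b ×ˢ Icc b d with hR
  have hRc : IsCompact R := isCompact_Icc.prod isCompact_Icc
  -- a linear functional that is nonnegative on the difference map near the corners
  set J := velocityDet γ (a, b) with hJdef
  -- The line through the crossing along the sum of the two velocities separates the loops there: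
  -- `l` is `-J²` on the velocity at `a` and `d`, and `J²` on that at `b`. Hence near their ends the
  -- first loop has `h ≤ h b` and the second `h ≥ h b`.
  set w := deriv γ a + deriv γ b with hw
  set l : ℝ × ℝ → ℝ := fun p => J * (w.1 * p.2 - w.2 * p.1) with hl
  have hlc : Continuous l := by fun_prop
  set h : ℝ → ℝ := fun s => l (γ s) with hh
  have hder (x : ℝ) : HasDerivAt h (l (deriv γ x)) x :=
    (((hasDerivAt_snd_of_contDiff hγ x).const_mul w.1).sub
      ((hasDerivAt_fst_of_contDiff hγ x).const_mul w.2)).const_mul J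
  have hla : l (deriv γ a) = -J ^ 2 := by
    simp only [hl, hw, hJdef, velocityDet, Prod.fst_add, Prod.snd_add]; ring
  have hlb : l (deriv γ b) = J ^ 2 := by
    simp only [hl, hw, hJdef, velocityDet, Prod.fst_add, Prod.snd_add]; ring
  have hJ2 : 0 < J ^ 2 := by positivity
  have eb := (hder b).eventually_sub_mul_sub_nonneg (by rw [hlb]; exact hJ2)
  have ea := (hder a).neg.eventually_sub_mul_sub_nonneg (by rw [hla, neg_neg]; exact hJ2)
  have ed := (hder d).neg.eventually_sub_mul_sub_nonneg (by rw [← hd, hla, neg_neg]; exact hJ2)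
  obtain ⟨Va, hVa, hVao, haV⟩ := eventually_nhds_iff.1 ea
  obtain ⟨Vb, hVb, hVbo, hbV⟩ := eventually_nhds_iff.1 eb
  obtain ⟨Vd, hVd, hVdo, hdV⟩ := eventually_nhds_iff.1 ed
  have hha : h a = h b := by simp only [hh, h₁]
  have hhd : h d = h b := by simp only [hh, h₂]
  set N : Set (ℝ × ℝ) := (Va ∪ Vb) ×ˢ (Vb ∪ Vd) with hN
  have hNo : IsOpen N := (hVao.union hVbo).prod (hVbo.union hVdo)
  have hcorner : ∀ z ∈ R, z ∈ N → 0 ≤ l (curveDifference γ z) := by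
    rintro ⟨s, t⟩ ⟨⟨hs1, hs2⟩, ht1, ht2⟩ ⟨hs, ht⟩
    simp only at hs1 hs2 ht1 ht2 hs ht
    have e : l (curveDifference γ (s, t)) = h t - h s := by
      simp only [hh, hl, curveDifference, Prod.fst_sub, Prod.snd_sub]; ring
    have h1 : h s ≤ h b := by
      rcases hs with hs | hs
      · have := hVa s hs
        simp only [Pi.neg_apply] at this
        rcases hs1.eq_or_lt with rfl | hlt
        · exact hha.le
        · nlinarith
      · have := hVb s hs
        rcases hs2.eq_or_lt with rfl | hlt
        · exact le_rfl
        · nlinarith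
    have h2 : h b ≤ h t := by
      rcases ht with ht | ht
      · have := hVb t ht
        rcases ht1.eq_or_lt with rfl | hlt
        · exact le_rfl
        · nlinarith
      · have := hVd t ht
        simp only [Pi.neg_apply] at this
        rcases ht2.eq_or_lt with rfl | hlt
        · exact hhd.ge
        · nlinarith
    linarith
  -- disjoint neighbourhoods of the intersection points
  obtain ⟨W, hWo, hWd⟩ := Z.finite_toSet.t2_separation
  have hloc : ∀ z ∈ Z, ∃ U ⊆ W z ∩ Ioo a b ×ˢ Ioo b d, IsOpen U ∧ z ∈ U ∧ ∃ r > 0,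
      ∀ φ : ℝ × ℝ → ℝ, (∀ p ∉ Metric.ball 0 r, φ p = 0) →
      ∫ w in U, φ (curveDifference γ w) * velocityDet γ w =
        (SignType.sign (velocityDet γ z) : ℤ) * ∫ p, φ p := fun z hz =>
    exists_nhds_setIntegral_curveDifference hγ ((hZ z).1 hz).2 (htr z hz)
      ((hWo z).2.inter (isOpen_Ioo.prod isOpen_Ioo)) ⟨(hWo z).1, ((hZ z).1 hz).1⟩
  choose! U hUW hUo hzU r hr hint using hloc
  have hUR : ∀ z ∈ Z, U z ⊆ R := fun z hz p hp =>
    ⟨Ioo_subset_Icc_self (hUW z hz hp).2.1, Ioo_subset_Icc_self (hUW z hz hp).2.2⟩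
  -- the difference map is bounded away from zero elsewhere
  have hKc : IsCompact (R \ (N ∪ ⋃ z ∈ Z, U z)) :=
    hRc.diff (hNo.union (isOpen_biUnion fun z hz => hUo z hz))
  obtain ⟨m, hm, hmK⟩ := hKc.exists_forall_le' (f := fun z => ‖curveDifference γ z‖)
    hFc.norm.continuousOn (a := 0) (by
      rintro ⟨s, t⟩ ⟨⟨hs, ht⟩, hzn⟩
      rw [norm_pos_iff]
      intro h0
      have heq : γ s = γ t := (sub_eq_zero.1 h0).symm
      simp only at hs ht
      refine hzn ?_
      -- Neither loop returns to the crossing in its interior, so a zero on the boundary of the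
      -- rectangle is a corner, covered by `N`; an interior zero belongs to `Z`.
      rcases hs.1.eq_or_lt with hsa | hsa
      · rcases ht.1.eq_or_lt with htb | htb
        · exact Or.inl ⟨Or.inl (hsa ▸ haV), Or.inl (htb ▸ hbV)⟩
        rcases ht.2.eq_or_lt with htd | htd
        · exact Or.inl ⟨Or.inl (hsa ▸ haV), Or.inr (htd ▸ hdV)⟩
        exact absurd (by rw [← heq, ← hsa, h₁]) (hB t ⟨htb, htd⟩)
      rcases hs.2.eq_or_lt with hsb | hsb
      · rcases ht.1.eq_or_lt with htb | htb
        · exact Or.inl ⟨Or.inr (hsb ▸ hbV), Or.inl (htb ▸ hbV)⟩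
        rcases ht.2.eq_or_lt with htd | htd
        · exact Or.inl ⟨Or.inr (hsb ▸ hbV), Or.inr (htd ▸ hdV)⟩
        exact absurd (by rw [← heq, hsb]) (hB t ⟨htb, htd⟩)
      rcases ht.1.eq_or_lt with htb | htb
      · exact absurd (by rw [heq, ← htb]) (hA s ⟨hsa, hsb⟩)
      rcases ht.2.eq_or_lt with htd | htd
      · exact absurd (by rw [heq, htd, h₂]) (hA s ⟨hsa, hsb⟩)
      have hz : (s, t) ∈ Z := (hZ _).2 ⟨⟨⟨hsa, hsb⟩, htb, htd⟩, heq⟩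
      exact Or.inr (mem_biUnion (show (s, t) ∈ (Z : Set (ℝ × ℝ)) from hz) (hzU _ hz)))
  -- a bump supported where the functional is negative
  set O : Set (ℝ × ℝ) := Metric.ball 0 m ∩ ⋂ z ∈ Z, Metric.ball 0 (r z) with hO
  have hOo : IsOpen O := Metric.isOpen_ball.inter
    (isOpen_biInter_finset fun _ _ => Metric.isOpen_ball)
  have h0O : (0 : ℝ × ℝ) ∈ O :=
    ⟨Metric.mem_ball_self hm, mem_iInter₂.2 fun z hz => Metric.mem_ball_self (hr z hz)⟩
  -- The bump is centred on the ray along `deriv γ a`, where `l < 0`, close enough to the origin to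
  -- lie in `O`.
  have htend : Filter.Tendsto (fun x : ℝ => x • deriv γ a) (𝓝 0) (𝓝 0) := by
    have : Continuous (fun x : ℝ => x • deriv γ a) := by fun_prop
    simpa using this.tendsto 0
  have hev : ∀ᶠ x : ℝ in 𝓝[>] 0, x • deriv γ a ∈ O :=
    nhdsWithin_le_nhds (htend (hOo.mem_nhds h0O))
  obtain ⟨x, hxO, hx⟩ := (hev.and self_mem_nhdsWithin).exists
  have hlq : l (x • deriv γ a) < 0 := by
    have : l (x • deriv γ a) = x * l (deriv γ a) := by
      simp only [hl, Prod.smul_fst, Prod.smul_snd, smul_eq_mul]; ring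
    rw [this, hla]
    have : 0 < x := hx
    nlinarith
  obtain ⟨ρ, hρ, hball⟩ := Metric.isOpen_iff.1 (hOo.inter (isOpen_lt hlc continuous_const))
    (x • deriv γ a) ⟨hxO, hlq⟩
  obtain ⟨f, k, hf, hk, hsupp, hI⟩ := exists_separated_bump (x • deriv γ a) hρ
  set φ : ℝ × ℝ → ℝ := fun p => f p.1 * k p.2 with hφ
  have hφO : ∀ p, ¬ (p ∈ O ∧ l p < 0) → φ p = 0 := fun p hp => hsupp p fun h => hp (hball h)
  have hφc : Continuous φ := by have := hk.continuous; fun_prop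
  have htot : ∫ z in R, φ (curveDifference γ z) * velocityDet γ z = 0 :=
    setIntegral_curveDifference_eq_zero hγ hab.le hbd.le h₁ h₂ hf hk
  have hcont : Continuous fun z => φ (curveDifference γ z) * velocityDet γ z :=
    (hφc.comp hFc).mul hJc
  rw [setIntegral_eq_of_subset_of_forall_sdiff_eq_zero (s := ⋃ z ∈ Z, U z) hRc.measurableSet
    (iUnion₂_subset hUR), integral_biUnion_finset Z (fun z hz => (hUo z hz).measurableSet)] at htot
  · rw [Finset.sum_congr rfl fun z hz => hint z hz φ fun p hp => hφO p fun h =>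
      hp (mem_iInter₂.1 h.1.2 z hz), ← Finset.sum_mul] at htot
    have := (mul_eq_zero.1 htot).resolve_right hI.ne'
    exact_mod_cast this
  · exact fun z hz z' hz' hne => (hWd hz hz' hne).mono (fun p hp => (hUW z hz hp).1)
      (fun p hp => (hUW z' hz' hp).1)
  · exact fun z hz => (hcont.continuousOn.integrableOn_compact hRc).mono_set (hUR z hz)
  -- Off the sets `U z`, the difference is either near a corner, with `l ≥ 0`, or of norm at least
  -- `m`; the bump vanishes in both cases.
  · rintro z ⟨hzR, hzU⟩
    rw [hφO, zero_mul]
    rintro ⟨hzO, hlz⟩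
    by_cases hzN : z ∈ N
    · exact hlz.not_ge (hcorner z hzR hzN)
    · have h1 := hmK z ⟨hzR, fun h => h.elim hzN hzU⟩
      have h2 := mem_ball_zero_iff.1 hzO.1
      exact h2.not_ge h1

/-! ### Cyclic order on the circle through real representatives -/

theorem UnitAddCircle.sbtw_coe_iff {ξ p q r : ℝ} (hp : p ∈ Ico ξ (ξ + 1)) (hq : q ∈ Ico ξ (ξ + 1))
    (hr : r ∈ Ico ξ (ξ + 1)) :
    sbtw (p : UnitAddCircle) (q : UnitAddCircle) (r : UnitAddCircle) ↔
      (p < q ∧ q < r) ∨ (q < r ∧ r < p) ∨ (r < p ∧ p < q) := by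
  obtain ⟨hp1, hp2⟩ := hp
  obtain ⟨hq1, hq2⟩ := hq
  obtain ⟨hr1, hr2⟩ := hr
  -- The endpoint conventions matter: `q = r` reduces to `r` but `p = r` to `r + 1`, which excludes
  -- both degenerate triples from strict betweenness.
  have h1 : toIcoMod (zero_lt_one' ℝ) r q = if r ≤ q then q else q + 1 := by
    split_ifs with h
    · exact (toIcoMod_eq_iff _).2 ⟨⟨h, by linarith⟩, 0, by simp⟩
    · exact (toIcoMod_eq_iff _).2 ⟨⟨by linarith, by linarith⟩, -1, by simp⟩
  have h2 : toIocMod (zero_lt_one' ℝ) r p = if r < p then p else p + 1 := by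
    split_ifs with h
    · exact (toIocMod_eq_iff _).2 ⟨⟨h, by linarith⟩, 0, by simp⟩
    · exact (toIocMod_eq_iff _).2 ⟨⟨by linarith, by linarith⟩, -1, by simp⟩
  rw [sbtw_iff_not_btw]
  have h3 : btw (r : UnitAddCircle) (q : UnitAddCircle) (p : UnitAddCircle) ↔
      toIcoMod (zero_lt_one' ℝ) r q ≤ toIocMod (zero_lt_one' ℝ) r p :=
    QuotientAddGroup.btw_coe_iff
  rw [h3, h1, h2, not_le]
  split_ifs <;> grind

/-- The representative in `[ξ, ξ + 1)` of a point of the circle. -/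
noncomputable def UnitAddCircle.lift (ξ : ℝ) (y : UnitAddCircle) : ℝ := AddCircle.equivIco 1 ξ y

namespace UnitAddCircle

theorem lift_mem (ξ : ℝ) (y : UnitAddCircle) : lift ξ y ∈ Ico ξ (ξ + 1) :=
  (AddCircle.equivIco 1 ξ y).2

@[simp] theorem coe_lift (ξ : ℝ) (y : UnitAddCircle) : (lift ξ y : UnitAddCircle) = y :=
  AddCircle.coe_equivIco

theorem lift_coe {ξ s : ℝ} (hs : s ∈ Ico ξ (ξ + 1)) : lift ξ (s : UnitAddCircle) = s :=
  AddCircle.equivIco_coe_of_mem hs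

theorem lift_self (ξ : ℝ) : lift ξ (ξ : UnitAddCircle) = ξ := lift_coe (by simp)

theorem lift_injective (ξ : ℝ) : Function.Injective (lift ξ) :=
  Subtype.val_injective.comp (AddCircle.equivIco 1 ξ).injective

theorem lt_lift {ξ : ℝ} {y : UnitAddCircle} (h : y ≠ ξ) : ξ < lift ξ y :=
  (lift_mem ξ y).1.lt_of_ne fun e => h (by rw [← coe_lift ξ y, ← e])

/-- The cut `ξ` is free: it is placed at the point under study or at the start of an arc, where the
cyclic order becomes a linear one. -/
theorem mem_cIoo_iff_lift (ξ : ℝ) {p q r : UnitAddCircle} : q ∈ cIoo p r ↔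
    (lift ξ p < lift ξ q ∧ lift ξ q < lift ξ r) ∨ (lift ξ q < lift ξ r ∧ lift ξ r < lift ξ p) ∨
      (lift ξ r < lift ξ p ∧ lift ξ p < lift ξ q) := by
  have := sbtw_coe_iff (lift_mem ξ p) (lift_mem ξ q) (lift_mem ξ r)
  simp only [coe_lift] at this
  exact this

/-- A point of the circle outside a finite set with at least two elements lies between exactly one
pair of consecutive elements of the set. -/
theorem existsUnique_consecutive {P : Set UnitAddCircle} (hP : P.Finite) {x : UnitAddCircle}
    (hx : x ∉ P) {u o : UnitAddCircle} (hu : u ∈ P) (ho : o ∈ P) (hux : x ∈ cIoo u o) :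
    ∃ e : UnitAddCircle × UnitAddCircle, e.1 ∈ P ∧ e.2 ∈ P ∧ e.1 ≠ e.2 ∧
      Disjoint (cIoo e.1 e.2) P ∧ x ∈ cIoo e.1 e.2 ∧ cIoo e.1 e.2 ⊆ cIoo u o ∧
      ∀ e' : UnitAddCircle × UnitAddCircle, e'.1 ∈ P → e'.2 ∈ P → Disjoint (cIoo e'.1 e'.2) P →
        x ∈ cIoo e'.1 e'.2 → e' = e := by
  obtain ⟨ξ, rfl⟩ := QuotientAddGroup.mk_surjective x
  change (ξ : UnitAddCircle) ∉ P at hx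
  change (ξ : UnitAddCircle) ∈ cIoo u o at hux
  have hlt : ∀ y ∈ P, ξ < lift ξ y := fun y hy => lt_lift (fun h => hx (h ▸ hy))
  -- With the circle cut at `x`, the next element of `P` has the smallest representative and the
  -- preceding one the largest.
  obtain ⟨e₂, he₂, hmin⟩ := hP.exists_minimalFor (lift ξ) P ⟨u, hu⟩
  obtain ⟨e₁, he₁, hmax⟩ := hP.exists_maximalFor (lift ξ) P ⟨u, hu⟩
  have hmin' : ∀ y ∈ P, lift ξ e₂ ≤ lift ξ y := fun y hy =>
    (le_total (lift ξ e₂) (lift ξ y)).elim id (hmin hy)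
  have hmax' : ∀ y ∈ P, lift ξ y ≤ lift ξ e₁ := fun y hy =>
    (le_total (lift ξ y) (lift ξ e₁)).elim id (hmax hy)
  have hself : lift ξ (ξ : UnitAddCircle) = ξ := lift_self ξ
  have huo : lift ξ o < lift ξ u := by
    rw [mem_cIoo_iff_lift ξ, hself] at hux
    have := hlt u hu
    have := hlt o ho
    grind
  have h12 : lift ξ e₂ < lift ξ e₁ := by linarith [hmin' o ho, hmax' u hu]
  refine ⟨(e₁, e₂), he₁, he₂, fun h => ?_, ?_, ?_, ?_, ?_⟩
  · simp only at h
    rw [h] at h12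
    exact h12.false
  · refine disjoint_left.2 fun y hy hyP => ?_
    rw [mem_cIoo_iff_lift ξ] at hy
    have := hmin' y hyP
    have := hmax' y hyP
    grind
  · rw [mem_cIoo_iff_lift ξ, hself]
    exact Or.inr (Or.inl ⟨hlt _ he₂, h12⟩)
  · intro y hy
    rw [mem_cIoo_iff_lift ξ] at hy ⊢
    have := hmin' o ho
    have := hmax' u hu
    grind
  · rintro ⟨f₁, f₂⟩ hf₁ hf₂ hdis hxf
    simp only at hf₁ hf₂ hdis hxf
    have h1 : e₁ ∉ cIoo f₁ f₂ := fun h => disjoint_left.1 hdis h he₁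
    have h2 : e₂ ∉ cIoo f₁ f₂ := fun h => disjoint_left.1 hdis h he₂
    rw [mem_cIoo_iff_lift ξ] at hxf h1 h2
    rw [hself] at hxf
    have := hlt f₁ hf₁
    have := hlt f₂ hf₂
    have := hmin' f₂ hf₂
    have := hmax' f₁ hf₁
    rw [Prod.mk.injEq]
    exact ⟨lift_injective ξ (by grind), lift_injective ξ (by grind)⟩

end UnitAddCircle

/-! ### Circle parameters and real parameters -/

namespace ImmersedClosedCurve

theorem curve_lift (γ : ImmersedClosedCurve) (ξ : ℝ) (s : UnitAddCircle) :
    γ.curve (lift ξ s) = γ.point s := by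
  conv_rhs => rw [← coe_lift ξ s]
  exact (γ.periodic.lift_coe _).symm

theorem point_coe (γ : ImmersedClosedCurve) (s : ℝ) : γ.point s = γ.curve s :=
  γ.periodic.lift_coe s

theorem det_coe (γ : ImmersedClosedCurve) (s t : ℝ) :
    γ.det s t = velocityDet γ.curve (s, t) := by
  have h (x : ℝ) : γ.velocity x = deriv γ.curve x := γ.periodic_deriv.lift_coe x
  simp only [det, velocityDet, h]

theorem velocityDet_lift (γ : ImmersedClosedCurve) (ξ : ℝ) (s t : UnitAddCircle) :
    velocityDet γ.curve (lift ξ s, lift ξ t) = γ.det s t := by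
  rw [← det_coe, coe_lift, coe_lift]

theorem det_swap (γ : ImmersedClosedCurve) (s t : UnitAddCircle) : γ.det s t = -γ.det t s := by
  simp only [det]; ring

theorem sign_det_swap (γ : ImmersedClosedCurve) (s t : UnitAddCircle) :
    (SignType.sign (γ.det s t) : ℤ) = -(SignType.sign (γ.det t s) : ℤ) := by
  rw [det_swap, Left.sign_neg, SignType.coe_neg]

theorem swap_mem_doublePairs {γ : ImmersedClosedCurve} {p : UnitAddCircle × UnitAddCircle}
    (hp : p ∈ γ.doublePairs) : p.swap ∈ γ.doublePairs :=
  ⟨hp.1.symm, hp.2.symm⟩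

end ImmersedClosedCurve

/-! ### Sign sums over a half of the diagram -/

namespace VirtualKnotDiagram

/-- Without triple points a passage determines its partner, hence also its crossing. -/
theorem fst_notMem_classicalPassages (D : VirtualKnotDiagram) {p : UnitAddCircle × UnitAddCircle}
    (hp : p ∈ D.virtualPairs) : p.1 ∉ D.classicalPassages := by
  rintro ⟨q, hq, hqp⟩
  have h2 : p.2 = q.2 := D.no_triple p.1 p.2 q.2 hp.1 (by
    have := D.classicalPairs_subset hq
    rwa [← hqp])
  exact hp.2 ((Prod.ext hqp h2.symm : q = p) ▸ hq)

open Classical in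
/-- On an arc between two classical passages, the virtual index cocycle sums the signs of all the
virtual passages of the arc. -/
theorem eval_virtualIndexCocycle (D : VirtualKnotDiagram) {u o : UnitAddCircle}
    (hu : u ∈ D.classicalPassages) (ho : o ∈ D.classicalPassages) :
    eval D.virtualIndexCocycle ⟨u, o⟩ =
      ∑ p ∈ D.finite_virtualPairs.toFinset with p.1 ∈ cIoo u o,
        (SignType.sign (D.det p.1 p.2) : ℤ) := by
  have hfin : D.classicalPassages.Finite := D.finite_classicalPairs.image _
  simp only [eval, virtualIndexCocycle]
  rw [Finset.sum_congr rfl fun e _ => Finset.sum_filter _ _, Finset.sum_comm,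
    Finset.sum_filter (fun p : UnitAddCircle × UnitAddCircle => p.1 ∈ cIoo u o)]
  refine Finset.sum_congr rfl fun p hp => ?_
  -- After exchanging the sums, a virtual passage in the half is counted once, since it lies on
  -- exactly one long arc and that arc is contained in the half.
  split_ifs with hpA
  · obtain ⟨e, he₁, he₂, hne, hdis, hpe, hsub, huniq⟩ := existsUnique_consecutive hfin
      (D.fst_notMem_classicalPassages (D.finite_virtualPairs.mem_toFinset.1 hp)) hu ho hpA
    refine (Finset.sum_eq_single (⟨e, he₁, he₂, hne, hdis⟩ : D.LongArc) ?_ ?_).trans (if_pos hpe)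
    · intro e' _ hne'
      refine if_neg fun hpe' => hne' (Subtype.ext ?_)
      exact huniq e'.1 e'.2.1 e'.2.2.1 e'.2.2.2.2 hpe'
    · intro h
      exact (h (Finset.mem_filter.2 ⟨Finset.mem_univ (α := D.LongArc) _, hsub⟩)).elim
  · refine Finset.sum_eq_zero fun e he => if_neg fun hpe => hpA ?_
    exact (Finset.mem_filter.1 he).2 hpe

open Classical in
/-- The two halves at a double point have intersection number zero. -/
theorem sum_sign_det_eq_zero_of_mem_of_notMem (D : VirtualKnotDiagram) {u o : UnitAddCircle}
    (huo : (u, o) ∈ D.doublePairs) :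
    ∑ p ∈ D.finite_doublePairs.toFinset with p.1 ∈ cIoo u o ∧ p.2 ∉ cIoo u o,
      (SignType.sign (D.det p.1 p.2) : ℤ) = 0 := by
  obtain ⟨a, rfl⟩ := QuotientAddGroup.mk_surjective u
  change ((a : UnitAddCircle), o) ∈ D.doublePairs at huo
  change ∑ p ∈ D.finite_doublePairs.toFinset with
    p.1 ∈ cIoo (a : UnitAddCircle) o ∧ p.2 ∉ cIoo (a : UnitAddCircle) o, _ = (0 : ℤ)
  -- The two halves become the real intervals from `a` to `b` and from `b` to `a + 1`.
  set b := lift a o with hb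
  have hbo : (b : UnitAddCircle) = o := coe_lift a o
  have hab : a < b := lt_lift huo.1.symm
  have hba : b < a + 1 := (lift_mem a o).2
  have hself : lift a (a : UnitAddCircle) = a := lift_self a
  have hcurve : D.curve a = D.curve b := by
    rw [← D.point_coe, ← D.point_coe, hbo]; exact huo.2
  have hmem (s : UnitAddCircle) : s ∈ cIoo (a : UnitAddCircle) o ↔ lift a s ∈ Ioo a b := by
    rw [mem_cIoo_iff_lift a, hself, mem_Ioo]
    have := (lift_mem a s).1
    grind
  have hne : ∀ s : UnitAddCircle, s ≠ a → s ≠ o → D.point s ≠ D.point a := fun s hsa hso h =>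
    hso (D.no_triple a s o ⟨hsa.symm, h.symm⟩ huo)
  have hne' : ∀ x ∈ Ico a (a + 1), x ≠ a → x ≠ b → D.curve x ≠ D.curve b := by
    intro x hx hxa hxb
    have hlx := lift_coe hx
    rw [← hcurve, ← D.point_coe, ← D.point_coe]
    refine hne x (fun h => hxa ?_) (fun h => hxb ?_)
    · rw [← hlx, h, hself]
    · rw [← hlx, h]
  set T := D.finite_doublePairs.toFinset.filter
    (fun p => p.1 ∈ cIoo (a : UnitAddCircle) o ∧ p.2 ∉ cIoo (a : UnitAddCircle) o) with hT
  have hmain := sum_sign_velocityDet_eq_zero D.contDiff hab hba hcurve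
    (by rw [← hcurve, D.periodic a]) (D.periodic_deriv a).symm
    (by rw [← D.det_coe, hbo]; exact D.transverse _ _ huo)
    (fun s hs => hne' s ⟨hs.1.le, hs.2.trans hba⟩ hs.1.ne' hs.2.ne)
    (fun t ht => hne' t ⟨(hab.trans ht.1).le, ht.2⟩ (hab.trans ht.1).ne' ht.1.ne')
    (T.image fun p => (lift a p.1, lift a p.2)) ?_ ?_
  · rw [Finset.sum_image] at hmain
    · simpa only [D.velocityDet_lift] using hmain
    · intro p _ q _ h
      rw [Prod.mk.injEq] at h
      exact Prod.ext (lift_injective a h.1) (lift_injective a h.2)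
  · intro z
    simp only [Finset.mem_image, hT, Finset.mem_filter, Set.Finite.mem_toFinset, hmem]
    constructor
    · rintro ⟨p, ⟨hp, hp1, hp2⟩, rfl⟩
      refine ⟨⟨hp1, ?_, (lift_mem a p.2).2⟩, by simp only [D.curve_lift]; exact hp.2⟩
      -- Being outside the open half still allows `p.2` to be an endpoint; this would put a third
      -- passage at the smoothed crossing.
      have hpa : D.point p.1 ≠ D.point a := by
        refine hne p.1 (fun h => ?_) (fun h => ?_)
        · rw [h, hself] at hp1; exact hp1.1.false
        · rw [h] at hp1; exact hp1.2.false
      have h2a : p.2 ≠ a := fun h => hpa (h ▸ hp.2)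
      have h2b : lift a p.2 ≠ b := fun h => hpa (by
        rw [hp.2, lift_injective a h]; exact huo.2.symm)
      have := lt_lift h2a
      exact lt_of_le_of_ne (not_lt.1 fun h => hp2 ⟨this, h⟩) h2b.symm
    · rintro ⟨⟨h1, h2⟩, hz⟩
      have l1 := lift_coe (ξ := a) (s := z.1) ⟨h1.1.le, h1.2.trans hba⟩
      have l2 := lift_coe (ξ := a) (s := z.2) ⟨(hab.trans h2.1).le, h2.2⟩
      refine ⟨(z.1, z.2), ⟨⟨fun h => ?_, ?_⟩, ?_, ?_⟩, ?_⟩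
      · simp only at h
        have h12 : z.1 = z.2 := by rw [← l1, h, l2]
        exact lt_asymm (h12 ▸ h1.2) h2.1
      · simpa only [D.point_coe] using hz
      · rwa [l1]
      · rw [l2]; exact fun h => lt_asymm h.2 h2.1
      · simp only [l1, l2]
  · intro z hz
    obtain ⟨p, hp, rfl⟩ := Finset.mem_image.1 hz
    rw [D.velocityDet_lift]
    exact D.transverse _ _ (D.finite_doublePairs.mem_toFinset.1 (Finset.mem_filter.1 hp).1)

open Classical in
/-- The signs of all the passages of a half through double points sum to zero. -/
theorem sum_sign_det_eq_zero (D : VirtualKnotDiagram) {u o : UnitAddCircle}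
    (huo : (u, o) ∈ D.doublePairs) :
    ∑ p ∈ D.finite_doublePairs.toFinset with p.1 ∈ cIoo u o,
      (SignType.sign (D.det p.1 p.2) : ℤ) = 0 := by
  rw [← Finset.sum_filter_add_sum_filter_not _
    (fun p : UnitAddCircle × UnitAddCircle => p.2 ∈ cIoo u o), Finset.filter_filter,
    Finset.filter_filter, D.sum_sign_det_eq_zero_of_mem_of_notMem huo, add_zero]
  -- A self-crossing of the half is passed twice, with opposite signs.
  refine Finset.sum_involution (fun p _ => p.swap) ?_ ?_ ?_ ?_
  · intro p _
    rw [Prod.fst_swap, Prod.snd_swap, D.sign_det_swap p.2 p.1, add_neg_cancel]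
  · intro p hp _ h
    have := (D.finite_doublePairs.mem_toFinset.1 (Finset.mem_filter.1 hp).1).1
    exact this (congrArg Prod.snd h)
  · intro p hp
    simp only [Finset.mem_filter, Set.Finite.mem_toFinset] at hp ⊢
    exact ⟨ImmersedClosedCurve.swap_mem_doublePairs hp.1, hp.2.2, hp.2.1⟩
  · exact fun p _ => p.swap_swap

/-- Both choices, of the left outgoing branch and of the half, depend on the sign in the same way,
so they compensate. -/
theorem Crossing.positiveHalf_eq {D : VirtualKnotDiagram} (c : D.Crossing) :
    c.positiveHalf = ⟨c.under, c.over⟩ := by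
  have hne : D.det c.over c.under ≠ 0 := D.transverse _ _ (D.crossings_subset c.2)
  unfold positiveHalf leftHalf rightHalf sign
  rcases lt_or_gt_of_ne hne with h | h
  · rw [sign_neg h, if_neg (by decide), if_neg h.not_gt]
  · rw [sign_pos h, if_pos (by decide), if_pos h]

end VirtualKnotDiagram

open VirtualKnotDiagram in
open Classical in
theorem mainTheorem2 (D : VirtualKnotDiagram) (c : D.Crossing) :
    D.virtualIndex c = D.index c := by
  have hc : (c.under, c.over) ∈ D.classicalPairs := Or.inr c.2
  have hc' : (c.over, c.under) ∈ D.classicalPairs := Or.inl c.2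
  have h0 := D.sum_sign_det_eq_zero (D.classicalPairs_subset hc)
  have hdisj : Disjoint D.finite_virtualPairs.toFinset D.finite_classicalPairs.toFinset := by
    rw [Set.Finite.disjoint_toFinset]
    exact disjoint_sdiff_left
  have hunion : D.finite_doublePairs.toFinset =
      D.finite_virtualPairs.toFinset ∪ D.finite_classicalPairs.toFinset := by
    ext p
    simp only [Set.Finite.mem_toFinset, Finset.mem_union, virtualPairs]
    rw [← Set.mem_union, Set.sdiff_union_of_subset D.classicalPairs_subset]
  rw [hunion, Finset.filter_union, Finset.sum_union (Finset.disjoint_filter_filter hdisj)] at h0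
  rw [virtualIndex, index, c.positiveHalf_eq, D.eval_virtualIndexCocycle ⟨_, hc, rfl⟩ ⟨_, hc', rfl⟩,
    eq_neg_of_add_eq_zero_left h0, ← Finset.sum_neg_distrib]
  exact Finset.sum_congr rfl fun p _ => (D.sign_det_swap p.2 p.1).symm
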